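/- Let $\mathcal X$ be a metric space with its Borel $\sigma$-algebra (for instance a smooth Riemannian manifold with its distance), $f:\mathcal X\to\mathcal X$ a measurable map, $\mu=\mathbb P$ an ergodic $f$-invariant Borel probability measure, and $\zeta$ a periodic point of $f$ of prime period $p$. Let $\varphi:\mathcal X\to[-\infty,\infty]$ be a measurable observable with a global maximum $u_F:=\varphi(\zeta)$ at $\zeta$; put $U(u)=\{x:\varphi(x)>u\}$, and assume that for $u<u_F$ close to $u_F$ the set $U(u)$ is a topological ball centred at $\zeta$ (a set homeomorphic to an open Euclidean ball, or half-ball, with $\zeta$ as centre) and that $u\mapsto\mu(U(u))$ is continuous on a neighbourhood of $u_F$ in $[-\infty,\infty]$. *Induced system.* Let $\hat{\mathcal X}\ni\zeta$ be a measurable set, $R(x)=\min\{n\ge1: f^n(x)\in\hat{\mathcal X}\}$ the first return time and $\hat f=f^{R}$ the first return map, which is defined at the points of $\hat{\mathcal X}$ that return to $\hat{\mathcal X}$. Assume that $R(\zeta)=p$ (so $\hat f(\zeta)=\zeta$) and that $U(u)\subset\hat{\mathcal X}$ for all $u<u_F$ close to $u_F$. Let $\hat\mu=\mu(\,\cdot\mid\hat{\mathcal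 X})$, let $\phi:\mathcal X\to\mathbb R$ be a measurable potential, $\hat\phi=\sum_{k=0}^{R-1}\phi\circ f^k$ its induced version, $\hat U(u)=U(u)\cap\hat{\mathcal X}$ and $\hat B_\delta(\zeta)=B_\delta(\zeta)\cap\hat{\mathcal X}$. Assume that $(\hat{\mathcal X},\hat f,\hat\phi)$ satisfies: * **(M1)** $P(\hat\phi):=\sup\{h(\nu)+\int\hat\phi\,d\nu\}=0$, where $\nu$ runs over the $\hat f$-invariant probability measures with $-\int\hat\phi\,d\nu<\infty$ and $h(\nu)$ is the metric entropy. * **(M2)** $\hat\mu$ is an equilibrium state for $\hat\phi$ (it realises the supremum in (M1)), and $\hat\mu=\rho\,m$ with $\rho:\hat{\mathcal X}\to[1/C,C]$ measurable for some $C>0$, where $m$ is a finite $\hat\phi$-conformal measure on $\hat{\mathcal X}$: $m(\hat f(A))=\int_Ae^{-\hat\phi}\,dm$ for every Borel set $A$ on which $\hat f$ is defined and injective. * **(S1)** For each $\varepsilon_0\in(0,1)$ there is a real $u_0<u_F$ such that $\hat U(u)$ is a topological ball centred at $\zeta$ for all $u\in(u_0-\varepsilon_0,u_F)$, and for each $u\in(u_0,u_F)$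 there are $n\in\mathbb N$, $n\ge1$, and $\varepsilon\in(0,\varepsilon_0)$ with $\hat U(u_0+\varepsilon)\subset\hat f^{n}(\hat U(u))\subset \hat U(u_0-\varepsilon)$. * **(S2)** For some $\delta>0$, $\hat f$ is defined and injective on $\hat B_\delta(\zeta)$, and there is $M<\infty$ such that for every $x\in \hat B_\delta(\zeta)$ there are points $x_n\in \hat B_\delta(\zeta)$, $n\ge0$, with $\hat f^n(x_n)=x$ and $\sum_{n\ge0}|\hat\phi(x_n)-\hat\phi(\zeta)|\le M$. Moreover $\hat\phi(\zeta)<0$. *Counting.* For $A\subset\mathbb R$ let $\mathscr N_u(A)=\#\{i\in A\cap\mathbb N_0:\varphi\circ f^i>u\}$ and $\hat{\mathscr N}_u(A)=\#\{i\in A\cap\mathbb N_0:\varphi\circ\hat f^i>u\}$, and let $v=1/\mu(U(u))$, $\hat v=1/\hat\mu(U(u))$ (read $1/0$ as $0$). Let $\mathcal R$ be the ring of finite unions of intervals $[a,b)$, $a,b\ge0$, and let $\mathcal J\subset\mathcal R$ be a family closed under $J\mapsto sJ$, $s>0$ (for example $\mathcal J=\mathcal R$, or the family of all intervals $[a,b)$).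 **Theorem.** Suppose that for all $J\in\mathcal J$ and $\kappa\in\mathbb N_0$ the limit $$\hat H(J,\kappa)=\lim_{u\nearrow u_F}\hat\mu\big(\hat{\mathscr N}_u(\hat vJ)\le\kappa\big)$$ exists, that $\hat H(J,\cdot)$ is the distribution function of an $\mathbb N_0$-valued random variable, and that $\lim_{\delta\to0}\hat H((1+\delta)J,\kappa)=\hat H(J,\kappa)$. Then for each $J\in\mathcal J$ there is a function $\delta_J(u)>0$, $u<u_F$, non-increasing in $u$ and with $\delta_J(u)\to0$ as $u\nearrow u_F$, such that for all real $u<u_F$ and all $\kappa\in\mathbb N_0$ $$\big|\mathbb P\big(\mathscr N_u(vJ)\le\kappa\big)-\hat H(J,\kappa)\big|<\delta_J(u).$$ -/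

import Mathlib

open MeasureTheory Filter Topology Set
open scoped ENNReal Pointwise

noncomputable section

namespace RareEvents

/-! ### Dynamical systems, first return maps, invariant measures -/

/-- A (possibly only partially defined) dynamical system inside `X`: the phase space is `carrier`,
the points of `domain` are those at which the map is defined, and the map is `map` restricted to
`domain` (the values of `map` off `domain` are irrelevant). -/
structure PartialSystem (X : Type*) where
  carrier : Set X
  domain : Set X
  map : X → X

/-- The points at which the first `n` iterates of the system are defined. -/
def PartialSystem.definedUpTo {X : Type*} (S : PartialSystem X) (n : ℕ) : Set X :=
  {x | ∀ k < n, S.map^[k] x ∈ S.domain}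

/-- The image of `A` under the `n`-th iterate of the system. -/
def PartialSystem.iterateImage {X : Type*} (S : PartialSystem X) (n : ℕ) (A : Set X) : Set X :=
  S.map^[n] '' (A ∩ S.definedUpTo n)

/-- First return time of `x` to `A` under `f`, the least `n ≥ 1` with `f^n x ∈ A`
(and `0` if there is no such `n`). -/
def firstReturnTime {X : Type*} (f : X → X) (A : Set X) (x : X) : ℕ :=
  sInf {n : ℕ | 1 ≤ n ∧ f^[n] x ∈ A}

/-- First return map to `A`. -/
def firstReturnMap {X : Type*} (f : X → X) (A : Set X) (x : X) : X :=
  f^[firstReturnTime f A x] x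

/-- The induced system: phase space `A`, with the first return map to `A`, defined at the points
of `A` that do return to `A`. -/
def inducedSystem {X : Type*} (f : X → X) (A : Set X) : PartialSystem X where
  carrier := A
  domain := {x | x ∈ A ∧ ∃ n : ℕ, 1 ≤ n ∧ f^[n] x ∈ A}
  map := firstReturnMap f A

/-- The induced version `φ + φ ∘ f + ⋯ + φ ∘ f^(R - 1)` of the potential `φ`, with `R` the first
return time to `A`. -/
def inducedPotential {X : Type*} (f : X → X) (A : Set X) (φ : X → ℝ) (x : X) : ℝ :=
  ∑ k ∈ Finset.range (firstReturnTime f A x), φ (f^[k] x)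

/-- `ν` is an invariant probability measure of the system `S`. -/
def PartialSystem.IsInvariant {X : Type*} [MeasurableSpace X] (S : PartialSystem X)
    (ν : Measure X) : Prop :=
  IsProbabilityMeasure ν ∧ ν S.domainᶜ = 0 ∧ MeasurePreserving S.map ν ν

/-! ### Metric entropy, pressure, equilibrium states, conformal measures -/

/-- Shannon entropy of the join of `ξ, T⁻¹ ξ, …, T^(-(n-1)) ξ`, where the finite partition `ξ` is
given by its labelling function. -/
def joinEntropy {X : Type*} [MeasurableSpace X] (ν : Measure X) (T : X → X) {k : ℕ}
    (ξ : X → Fin k) (n : ℕ) : ℝ :=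
  ∑ w : Fin n → Fin k, Real.negMulLog (ν.real {x | ∀ i : Fin n, ξ (T^[(i : ℕ)] x) = w i})

/-- Kolmogorov–Sinai entropy `h(ν)` of `T`: supremum over finite measurable partitions `ξ` of
`lim (1/n) H(ξ ∨ ⋯ ∨ T^(-(n-1)) ξ)`. -/
def metricEntropy {X : Type*} [MeasurableSpace X] (ν : Measure X) (T : X → X) : ℝ≥0∞ :=
  ⨆ (k : ℕ) (ξ : X → Fin k) (_ : Measurable ξ),
    limsup (fun n : ℕ => ENNReal.ofReal (joinEntropy ν T ξ n / n)) atTop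

/-- `-∫ φ dν < ∞`: the integral of `φ` exists and is not `-∞`. -/
def NegPartIntegrable {X : Type*} [MeasurableSpace X] (φ : X → ℝ) (ν : Measure X) : Prop :=
  ∫⁻ x, ENNReal.ofReal (-φ x) ∂ν < ∞

/-- `∫ φ dν` as an extended real, for `φ` with integrable negative part. -/
def extIntegral {X : Type*} [MeasurableSpace X] (φ : X → ℝ) (ν : Measure X) : EReal :=
  ((∫⁻ x, ENNReal.ofReal (φ x) ∂ν : ℝ≥0∞) : EReal) -
    ((∫⁻ x, ENNReal.ofReal (-φ x) ∂ν : ℝ≥0∞) : EReal)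

/-- The pressure `P(φ) = sup {h(ν) + ∫ φ dν : ν invariant, -∫ φ dν < ∞}`. -/
def pressure {X : Type*} [MeasurableSpace X] (S : PartialSystem X) (φ : X → ℝ) : EReal :=
  sSup {a : EReal | ∃ ν : Measure X, S.IsInvariant ν ∧ NegPartIntegrable φ ν ∧
    a = (metricEntropy ν S.map : EReal) + extIntegral φ ν}

/-- Equilibrium states: invariant probability measures that realise the pressure. -/
def IsEquilibriumState {X : Type*} [MeasurableSpace X] (S : PartialSystem X) (φ : X → ℝ)
    (ν : Measure X) : Prop :=
  S.IsInvariant ν ∧ NegPartIntegrable φ ν ∧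
    (metricEntropy ν S.map : EReal) + extIntegral φ ν = pressure S φ

/-- `m` is a finite `φ`-conformal measure on the phase space of `S`: `m (T A) = ∫_A e^(-φ) dm` for
every Borel set `A` on which the map `T` of the system is injective. -/
def IsConformal {X : Type*} [MeasurableSpace X] (S : PartialSystem X) (φ : X → ℝ)
    (m : Measure X) : Prop :=
  IsFiniteMeasure m ∧ m S.carrierᶜ = 0 ∧
    ∀ A : Set X, MeasurableSet A → A ⊆ S.domain → InjOn S.map A →
      m (S.map '' A) = ∫⁻ x in A, ENNReal.ofReal (Real.exp (-φ x)) ∂m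

/-- Condition (M1): zero pressure. -/
def CondM1 {X : Type*} [MeasurableSpace X] (S : PartialSystem X) (φ : X → ℝ) : Prop :=
  pressure S φ = 0

/-- Condition (M2): `ν` is an equilibrium state with `ν = ρ m`, where `m` is a finite `φ`-conformal
measure and `ρ` takes values in `[1/C, C]` on the phase space. -/
def CondM2 {X : Type*} [MeasurableSpace X] (S : PartialSystem X) (φ : X → ℝ)
    (ν : Measure X) : Prop :=
  IsEquilibriumState S φ ν ∧
    ∃ (m : Measure X) (ρ : X → ℝ) (C : ℝ), IsConformal S φ m ∧ Measurable ρ ∧ 0 < C ∧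
      (∀ x ∈ S.carrier, ρ x ∈ Icc (1 / C) C) ∧
      ν = m.withDensity (fun x => ENNReal.ofReal (ρ x))

/-! ### Exceedances and scaling near the periodic point -/

/-- `U(u) = {x : ϕ x > u}`. -/
def exceedanceSet {X : Type*} (ϕ : X → EReal) (u : EReal) : Set X := {x | u < ϕ x}

/-- The filter "`u → uF`, `u < uF`" on real levels `u`. -/
def levelFilter (uF : EReal) : Filter ℝ := comap (fun u : ℝ => (u : EReal)) (𝓝[<] uF)

/-- `U` is a topological ball centred at `ζ`: it is homeomorphic to an open Euclidean ball (or, for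
spaces with boundary, to a half-ball), with `ζ` corresponding to the centre. -/
def IsTopologicalBall {X : Type*} [TopologicalSpace X] (ζ : X) (U : Set X) : Prop :=
  ∃ hζ : ζ ∈ U, ∃ (d : ℕ) (K : Set (EuclideanSpace ℝ (Fin d))),
    (K = univ ∨ ∃ i : Fin d, K = {y | 0 ≤ y i}) ∧
    ∃ e : U ≃ₜ ↥(Metric.ball (0 : EuclideanSpace ℝ (Fin d)) 1 ∩ K),
      (e ⟨ζ, hζ⟩ : EuclideanSpace ℝ (Fin d)) = 0

/-- Condition (R1): for `u` close to `uF = ϕ ζ` the set `U(u)` is a topological ball centred at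
`ζ`, and `u ↦ μ (U(u))` is continuous on a neighbourhood of `uF`. -/
def CondR1 {X : Type*} [TopologicalSpace X] [MeasurableSpace X] (μ : Measure X) (ϕ : X → EReal)
    (ζ : X) : Prop :=
  (∀ᶠ u : ℝ in levelFilter (ϕ ζ), IsTopologicalBall ζ (exceedanceSet ϕ (u : EReal))) ∧
    ∃ W ∈ 𝓝 (ϕ ζ), ContinuousOn (fun u : EReal => μ (exceedanceSet ϕ u)) W

/-- Condition (S1) for the system `S` and its periodic point `ζ` of period `q`; here `U(u)` is
taken inside the phase space of `S`. -/
def CondS1 {X : Type*} [TopologicalSpace X] (S : PartialSystem X) (ϕ : X → EReal) (ζ : X)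
    (q : ℕ) : Prop :=
  ∀ ε₀ ∈ Ioo (0 : ℝ) 1, ∃ u₀ : ℝ, (u₀ : EReal) < ϕ ζ ∧
    (∀ u : ℝ, u₀ - ε₀ < u → (u : EReal) < ϕ ζ →
      IsTopologicalBall ζ (S.carrier ∩ exceedanceSet ϕ (u : EReal))) ∧
    ∀ u : ℝ, u₀ < u → (u : EReal) < ϕ ζ → ∃ n : ℕ, 1 ≤ n ∧ ∃ ε ∈ Ioo (0 : ℝ) ε₀,
      S.carrier ∩ exceedanceSet ϕ ((u₀ + ε : ℝ) : EReal) ⊆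
        S.iterateImage (n * q) (S.carrier ∩ exceedanceSet ϕ (u : EReal)) ∧
      S.iterateImage (n * q) (S.carrier ∩ exceedanceSet ϕ (u : EReal)) ⊆
        S.carrier ∩ exceedanceSet ϕ ((u₀ - ε : ℝ) : EReal)

/-- Condition (S2) for the system `S`, the potential `φ` and the periodic point `ζ` of period `q`;
the ball `B_δ(ζ)` is the one in the phase space of `S`. -/
def CondS2 {X : Type*} [MetricSpace X] (S : PartialSystem X) (φ : X → ℝ) (ζ : X)
    (q : ℕ) : Prop :=
  (∃ δ > (0 : ℝ),
    S.carrier ∩ Metric.ball ζ δ ⊆ S.definedUpTo q ∧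
    InjOn S.map^[q] (S.carrier ∩ Metric.ball ζ δ) ∧
    ∃ M : ℝ, ∀ x ∈ S.carrier ∩ Metric.ball ζ δ, ∃ y : ℕ → X,
      (∀ n, y n ∈ S.carrier ∩ Metric.ball ζ δ ∧ y n ∈ S.definedUpTo (q * n) ∧
        S.map^[q * n] (y n) = x) ∧
      Summable (fun n => |φ (y n) - φ ζ|) ∧ ∑' n, |φ (y n) - φ ζ| ≤ M) ∧
  φ ζ < 0

/-! ### Counting exceedances -/

/-- The semi-ring of intervals `[a, b)` with `a, b ≥ 0`. -/
def intervalSemiring : Set (Set ℝ) := {J | ∃ a b : ℝ, 0 ≤ a ∧ 0 ≤ b ∧ J = Ico a b}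

/-- The ring generated by the intervals `[a, b)`, `a, b ≥ 0`: their finite unions. -/
def intervalRing : Set (Set ℝ) :=
  {J | ∃ F : Set (Set ℝ), F.Finite ∧ F ⊆ intervalSemiring ∧ J = ⋃₀ F}

/-- The number of exceedances of the level `u` by `ϕ, ϕ ∘ T, ϕ ∘ T^2, …` at (integer) times
in `A`. -/
def exceedanceCount {X : Type*} (T : X → X) (ϕ : X → EReal) (u : ℝ) (A : Set ℝ) (x : X) : ℕ∞ :=
  Set.encard {i : ℕ | (i : ℝ) ∈ A ∧ (u : EReal) < ϕ (T^[i] x)}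

/-- The counting distribution `ν (𝒩_u(vJ) ≤ κ)` of the map `T` with respect to the measure `ν`,
with normalisation `v = 1 / ν (U(u))`. -/
def countingDistribution {X : Type*} [MeasurableSpace X] (ν : Measure X) (T : X → X)
    (ϕ : X → EReal) (u : ℝ) (J : Set ℝ) (κ : ℕ) : ℝ :=
  ν.real {x | exceedanceCount T ϕ u ((1 / ν.real (exceedanceSet ϕ (u : EReal))) • J) x ≤ κ}

/-- `F` is the distribution function, restricted to `ℕ`, of a random variable with values
in `ℕ`. -/
def IsNatDistributionFunction (F : ℕ → ℝ) : Prop :=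
  0 ≤ F 0 ∧ Monotone F ∧ Tendsto F atTop (𝓝 1)

end RareEvents

end

namespace RareEvents

/-! ### The mean ergodic theorem in `L¹` -/

section MeanErgodic

variable {X : Type*} [MeasurableSpace X] {μ : Measure X} {f : X → X}

/-! Write `s` for the inducing set, `m = μ(s)`, `ν = μ(· | s)`, and let `U ⊆ s` be a small
exceedance set. It suffices that the hit counts of `U` under `(f, μ)` and under the return map with
`ν`, each on its own time scale, have nearly the same law. Two comparisons give this.

Change of measure: the event "at most `κ` hits in `c • J`" is almost invariant, since shifting the
orbit by one step alters the count only through a hit at time `0` or at one of the finitely many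
rounded endpoints of `c • J`. An almost invariant event is almost independent of `s`, because
averaging over translates of `s` lets the mean ergodic theorem replace the indicator of `s` by `m`.
So `μ` may be replaced by `ν` (`exists_forall_abs_hitCount_cond_sub_le`).

Change of clock: as `U ⊆ s`, both systems see the same hits along an orbit, only timed differently.
By the ergodic theorem about `m c e` returns occur before time `c e`, with error `o(c)`, and `m c =
1 / ν(U)` for `c = 1 / μ(U)`. The counts can then differ only through a hit within `o(c)` of an
endpoint, which has small probability (`exists_forall_abs_hitCount_firstReturnMap_sub_le`).

Convergence to a distribution function on `ℕ` is uniform in `κ`, and the supremum of the errors over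
all higher levels yields a monotone bound. -/

theorem coeFn_birkhoffAverage_compMeasurePreserving (hf : MeasurePreserving f μ μ) {g : X → ℝ}
    (hg : MemLp g 2 μ) (n : ℕ) :
    ((birkhoffAverage ℝ (Lp.compMeasurePreservingₗᵢ (p := 2) ℝ f hf).toContinuousLinearMap id n
      (hg.toLp g) : Lp ℝ 2 μ) : X → ℝ) =ᵐ[μ] birkhoffAverage ℝ f g n := by
  have hiter : ∀ k : ℕ,
      ((Lp.compMeasurePreservingₗᵢ (p := 2) ℝ f hf).toContinuousLinearMap)^[k] (hg.toLp g) =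
        (hg.comp_measurePreserving (hf.iterate k)).toLp _ := by
    intro k
    have := congrFun (Lp.compMeasurePreserving_iterate (E := ℝ) (p := 2) hf k) (hg.toLp g)
    rw [Lp.toLp_compMeasurePreserving] at this
    exact this
  have hsum : birkhoffAverage ℝ
      (Lp.compMeasurePreservingₗᵢ (p := 2) ℝ f hf).toContinuousLinearMap id n (hg.toLp g) =
      (n : ℝ)⁻¹ • ∑ k ∈ Finset.range n,
        (hg.comp_measurePreserving (hf.iterate k)).toLp _ := by
    simp only [birkhoffAverage, birkhoffSum, id, hiter]
  rw [hsum]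
  have hall : ∀ᵐ x ∂μ, ∀ k : ℕ,
      ((hg.comp_measurePreserving (hf.iterate k)).toLp _ : X → ℝ) x = g (f^[k] x) := by
    rw [ae_all_iff]
    intro k
    exact (hg.comp_measurePreserving (hf.iterate k)).coeFn_toLp
  filter_upwards [hall, Lp.coeFn_smul (n : ℝ)⁻¹ (∑ k ∈ Finset.range n,
        (hg.comp_measurePreserving (hf.iterate k)).toLp _),
      Lp.coeFn_fun_finsetSum (Finset.range n)
        (fun k => (hg.comp_measurePreserving (hf.iterate k)).toLp _)] with x h1 h2 h3
  rw [h2, Pi.smul_apply, h3]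
  simp only [birkhoffAverage, birkhoffSum, h1]

theorem integral_birkhoffAverage (hf : MeasurePreserving f μ μ) {g : X → ℝ}
    (hg : Integrable g μ) {n : ℕ} (hn : n ≠ 0) :
    ∫ x, birkhoffAverage ℝ f g n x ∂μ = ∫ x, g x ∂μ := by
  simp only [birkhoffAverage, birkhoffSum, smul_eq_mul]
  rw [integral_const_mul, integral_finsetSum]
  · have : ∀ k ∈ Finset.range n, ∫ x, g (f^[k] x) ∂μ = ∫ x, g x ∂μ := by
      intro k _
      have hk := hf.iterate k
      rw [← integral_map hk.aemeasurable (by rw [hk.map_eq]; exact hg.aestronglyMeasurable),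
        hk.map_eq]
    rw [Finset.sum_congr rfl this]
    have : (n : ℝ) ≠ 0 := by exact_mod_cast hn
    simp [this]
  · intro k _
    exact (hf.iterate k).integrable_comp_of_integrable hg

/-- The mean ergodic theorem for an ergodic map, in `L¹`. -/
theorem tendsto_integral_abs_birkhoffAverage_sub [IsProbabilityMeasure μ] (hf : Ergodic f μ) {g : X → ℝ}
    (hg : MemLp g 2 μ) :
    Tendsto (fun n : ℕ => ∫ x, |birkhoffAverage ℝ f g n x - ∫ y, g y ∂μ| ∂μ) atTop (𝓝 0) := by
  have hmp := hf.toMeasurePreserving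
  set K := (Lp.compMeasurePreservingₗᵢ (E := ℝ) (p := 2) ℝ f hmp).toContinuousLinearMap with hK
  have hK1 : ‖K‖ ≤ 1 := LinearIsometry.norm_toContinuousLinearMap_le _
  obtain ⟨P, hP, hlim⟩ : ∃ P : Lp ℝ 2 μ, K P = P ∧
      Tendsto (birkhoffAverage ℝ K id · (hg.toLp g)) atTop (𝓝 P) :=
    ⟨_, (((K.eqLocus (1 : Lp ℝ 2 μ →L[ℝ] Lp ℝ 2 μ)).orthogonalProjectionOnto (hg.toLp g)).2 : _),
      K.tendsto_birkhoffAverage_orthogonalProjection hK1 (hg.toLp g)⟩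
  -- The limit is fixed by the Koopman operator, so ergodicity makes it constant.
  obtain ⟨c, hc⟩ : ∃ c : ℝ, (P : X → ℝ) =ᵐ[μ] Function.const X c := by
    apply hf.ae_eq_const_of_ae_eq_comp_ae (Lp.aestronglyMeasurable P)
    have h := Lp.coeFn_compMeasurePreserving P hmp
    have h' : Lp.compMeasurePreserving f hmp P = P := hP
    rw [h'] at h
    exact h.symm
  have hgi : Integrable g μ := hg.integrable (by norm_num)
  have hAi : ∀ n, Integrable (birkhoffAverage ℝ f g n) μ := by
    intro n
    change Integrable (fun x => birkhoffAverage ℝ f g n x) μ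
    simp only [birkhoffAverage, birkhoffSum, smul_eq_mul]
    refine Integrable.const_mul (integrable_finsetSum _ fun k _ => ?_) _
    exact (hmp.iterate k).integrable_comp_of_integrable hgi
  have hL1 : Tendsto (fun n : ℕ => ∫ x, |birkhoffAverage ℝ f g n x - c| ∂μ) atTop (𝓝 0) := by
    have hnorm : Tendsto (fun n => ‖birkhoffAverage ℝ K id n (hg.toLp g) - P‖) atTop (𝓝 0) :=
      tendsto_iff_norm_sub_tendsto_zero.1 hlim
    refine squeeze_zero (fun n => integral_nonneg fun x => abs_nonneg _) (fun n => ?_) hnorm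
    have hae : (birkhoffAverage ℝ K id n (hg.toLp g) - P : Lp ℝ 2 μ) =ᵐ[μ]
        fun x => birkhoffAverage ℝ f g n x - c := by
      filter_upwards [Lp.coeFn_sub (birkhoffAverage ℝ K id n (hg.toLp g)) P, hc,
        coeFn_birkhoffAverage_compMeasurePreserving hmp hg n] with x h1 h2 h3
      rw [h1, Pi.sub_apply, h2, h3, Function.const_apply]
    have hmeas : AEStronglyMeasurable (fun x => birkhoffAverage ℝ f g n x - c) μ :=
      (hAi n).aestronglyMeasurable.sub aestronglyMeasurable_const
    rw [Lp.norm_def, eLpNorm_congr_ae hae]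
    have h12 := eLpNorm_le_eLpNorm_of_exponent_le (p := 1) (q := 2) (by norm_num) hmeas
    have hfin : eLpNorm (fun x => birkhoffAverage ℝ f g n x - c) 2 μ ≠ ∞ := by
      rw [← eLpNorm_congr_ae hae]
      exact Lp.eLpNorm_ne_top _
    refine le_trans (le_of_eq ?_) (ENNReal.toReal_mono hfin h12)
    rw [eLpNorm_one_eq_lintegral_enorm, ← integral_norm_eq_lintegral_enorm hmeas]
    rfl
  -- Birkhoff averages keep the integral of `g`, and `L¹` convergence passes it to the limit.
  suffices hcg : c = ∫ y, g y ∂μ by rwa [← hcg]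
  have h2 : Tendsto (fun n : ℕ => |(∫ y, g y ∂μ) - c|) atTop (𝓝 0) := by
    refine squeeze_zero' (Eventually.of_forall fun n => abs_nonneg _) ?_ hL1
    filter_upwards [eventually_ne_atTop 0] with n hn
    rw [← integral_birkhoffAverage hmp hgi hn]
    have : (∫ x, birkhoffAverage ℝ f g n x ∂μ) - c =
        ∫ x, (birkhoffAverage ℝ f g n x - c) ∂μ := by
      rw [integral_sub (hAi n) (integrable_const c)]
      simp
    rw [this]
    exact abs_integral_le_integral_abs
  have h3 := tendsto_nhds_unique h2 tendsto_const_nhds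
  linarith [abs_eq_zero.1 h3.symm]

end MeanErgodic

/-! ### Step sets -/

/-- Membership of `t` in `J` depends only on which of the points of `E ⊆ [0, ∞)` are `≤ t`. -/
def IsStepSet (J : Set ℝ) (E : Finset ℝ) : Prop :=
  (∀ e ∈ E, 0 ≤ e) ∧ ∀ s t : ℝ, (∀ e ∈ E, e ≤ s ↔ e ≤ t) → (s ∈ J ↔ t ∈ J)

theorem exists_isStepSet_of_mem_intervalRing {J : Set ℝ} (hJ : J ∈ intervalRing) :
    ∃ E : Finset ℝ, IsStepSet J E := by
  obtain ⟨F, hF, hsub, rfl⟩ := hJ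
  induction F, hF using Set.Finite.induction_on with
  | empty => exact ⟨∅, by simp [IsStepSet]⟩
  | @insert I F _ _ ih =>
    obtain ⟨E, hE0, hE⟩ := ih fun I hI => hsub (mem_insert_of_mem _ hI)
    obtain ⟨a, b, ha, hb, rfl⟩ := hsub (mem_insert _ _)
    refine ⟨insert a (insert b E), ?_, fun s t h => ?_⟩
    · simp only [Finset.mem_insert]
      rintro e (rfl | rfl | he)
      exacts [ha, hb, hE0 e he]
    · have h1 := h a (by simp)
      have h2 := h b (by simp)
      have h3 := hE s t fun e he => h e (by simp [he])
      rw [sUnion_insert, mem_union, mem_union, h3, mem_Ico, mem_Ico, h1, ← not_le, ← not_le, h2]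

/-! ### Hitting counts -/

section HitCount

variable {X : Type*}

/-- The number of times `i ∈ A` with `T^i x ∈ U`. -/
noncomputable def hitCount (T : X → X) (U : Set X) (A : Set ℝ) (x : X) : ℕ∞ :=
  Set.encard {i : ℕ | (i : ℝ) ∈ A ∧ T^[i] x ∈ U}

theorem encard_le_natCast_iff {α : Type*} (S : Set α) (k : ℕ) :
    S.encard ≤ k ↔ ∀ t : Finset α, t.card = k + 1 → ¬ (t : Set α) ⊆ S := by
  constructor
  · intro h t ht hS
    have := (encard_le_encard hS).trans h
    rw [encard_coe_eq_coe_finsetCard, ht] at this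
    norm_cast at this
    omega
  · intro h
    by_contra! hlt
    have hle : ((k + 1 : ℕ) : ℕ∞) ≤ S.encard := by
      push_cast
      exact Order.add_one_le_of_lt hlt
    obtain ⟨t, htS, ht⟩ := exists_subset_encard_eq hle
    have hfin : t.Finite := finite_of_encard_eq_coe ht
    refine h hfin.toFinset ?_ (by simpa using htS)
    rw [hfin.encard_eq_coe_toFinset_card] at ht
    exact_mod_cast ht

/-- The event says that no `κ + 1` distinct times are all hits, a countable intersection over finite
sets of times. -/
theorem measurableSet_hitCount_le [MeasurableSpace X] {T : X → X} (hT : Measurable T) {U : Set X}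
    (hU : MeasurableSet U) (A : Set ℝ) (κ : ℕ) :
    MeasurableSet {x | hitCount T U A x ≤ κ} := by
  have : {x | hitCount T U A x ≤ κ} = ⋂ (t : Finset ℕ) (_ : t.card = κ + 1), ⋃ (i ∈ t),
      {x | ¬ ((i : ℝ) ∈ A ∧ T^[i] x ∈ U)} := by
    ext x
    simp only [hitCount, mem_ofPred_eq, encard_le_natCast_iff, mem_iInter, mem_iUnion,
      Set.not_subset, Finset.mem_coe, exists_prop]
  rw [this]
  refine MeasurableSet.iInter fun t => MeasurableSet.iInter fun _ =>
    Finset.measurableSet_biUnion _ fun i _ => ?_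
  by_cases hi : (i : ℝ) ∈ A
  · simp only [hi, true_and]
    exact ((hT.iterate i) hU).compl
  · simp [hi]

theorem measureReal_hitCount_le_eq_one [MeasurableSpace X] {ν : Measure X}
    [IsProbabilityMeasure ν] {T : X → X} (hT : MeasurePreserving T ν ν) {U : Set X}
    (hU : MeasurableSet U) (h0 : ν U = 0) (A : Set ℝ) (κ : ℕ) :
    ν.real {x | hitCount T U A x ≤ κ} = 1 := by
  have hae : ∀ᵐ x ∂ν, x ∈ {x | hitCount T U A x ≤ κ} := by
    have : ∀ᵐ x ∂ν, ∀ i : ℕ, T^[i] x ∉ U := by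
      rw [ae_all_iff]
      intro i
      have := (hT.iterate i).measure_preimage hU.nullMeasurableSet
      rw [h0] at this
      exact measure_eq_zero_iff_ae_notMem.1 this
    filter_upwards [this] with x hx
    simp [hitCount, hx]
  have huniv : {x | hitCount T U A x ≤ κ} =ᵐ[ν] univ := eventuallyEq_univ.2 hae
  rw [measureReal_def, measure_congr huniv, measure_univ, ENNReal.toReal_one]

variable {f : X → X}

/-- Hits of `f x` are hits of `x` moved back by one. Times `i` and `i + 1` lie on different sides of
an endpoint `c * e` only when `i + 1 = ⌈c * e⌉₊`, and time `0` has no predecessor; no hit occurs at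
any of these times. -/
theorem hitCount_comp_self {U : Set X} {J : Set ℝ} {E : Finset ℝ} (hJ : IsStepSet J E) {c : ℝ}
    (hc : 0 < c) {x : X} (hx : x ∉ U) (hxE : ∀ e ∈ E, f^[⌈c * e⌉₊] x ∉ U) :
    hitCount f U (c • J) (f x) = hitCount f U (c • J) x := by
  have key : {i : ℕ | (i : ℝ) ∈ c • J ∧ f^[i] x ∈ U} =
      Nat.succ '' {i : ℕ | (i : ℝ) ∈ c • J ∧ f^[i] (f x) ∈ U} := by
    have hstep : ∀ i : ℕ, f^[i + 1] x ∈ U →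
        (((i : ℕ) : ℝ) ∈ c • J ↔ ((i + 1 : ℕ) : ℝ) ∈ c • J) := by
      intro i hi
      rw [mem_smul_set_iff_inv_smul_mem₀ hc.ne', mem_smul_set_iff_inv_smul_mem₀ hc.ne']
      refine hJ.2 _ _ fun e he => ?_
      simp only [smul_eq_mul]
      rw [le_inv_mul_iff₀ hc, le_inv_mul_iff₀ hc, ← Nat.ceil_le, ← Nat.ceil_le]
      constructor
      · intro h; omega
      · intro h
        by_contra hlt
        have : ⌈c * e⌉₊ = i + 1 := by omega
        exact hxE e he (this ▸ hi)
    ext i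
    constructor
    · rintro ⟨h1, h2⟩
      cases i with
      | zero => exact absurd h2 hx
      | succ i => exact ⟨i, ⟨(hstep i h2).2 h1, h2⟩, rfl⟩
    · rintro ⟨i, ⟨h1, h2⟩, rfl⟩
      exact ⟨(hstep i h2).1 h1, h2⟩
  rw [hitCount, hitCount, key, Nat.succ_injective.encard_image]

/-! ### The first return map along an orbit -/

/-- Successive returns enumerate the visit times to `s`, starting from the visit at time `0`.
Infinitely many visits keep `Nat.nth` away from its default value. -/
theorem iterate_firstReturnMap {s : Set X} {x : X} (hx : x ∈ s)
    (hinf : {n : ℕ | f^[n] x ∈ s}.Infinite) (j : ℕ) :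
    (firstReturnMap f s)^[j] x = f^[Nat.nth (fun n => f^[n] x ∈ s) j] x := by
  set p : ℕ → Prop := fun n => f^[n] x ∈ s with hp
  induction j with
  | zero =>
    rw [Nat.nth_zero_of_zero (show p 0 from hx)]
    rfl
  | succ j ih =>
    rw [Function.iterate_succ_apply', ih, firstReturnMap, ← Function.iterate_add_apply]
    congr 2
    have hlt : Nat.nth p j < Nat.nth p (j + 1) := (Nat.nth_lt_nth hinf).2 (Nat.lt_succ_self j)
    have hleast : IsLeast {n : ℕ | 1 ≤ n ∧ f^[n] (f^[Nat.nth p j] x) ∈ s}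
        (Nat.nth p (j + 1) - Nat.nth p j) := by
      constructor
      · refine ⟨by omega, ?_⟩
        rw [← Function.iterate_add_apply, Nat.sub_add_cancel hlt.le]
        exact Nat.nth_mem_of_infinite hinf (j + 1)
      · rintro n ⟨hn1, hn⟩
        rw [← Function.iterate_add_apply] at hn
        by_contra! hlt'
        have := Nat.le_nth_of_lt_nth_succ (p := p) (k := j) (a := n + Nat.nth p j) (by omega) hn
        omega
    rw [firstReturnTime, hleast.csInf_eq]
    omega

open Classical in
-- Every hit of `U` is a visit to `s`, so `Nat.nth` matches hits of the return map with hits of `f`.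
-- Time `nth j` is past `c * e` exactly when at most `j` visits precede it; the hypothesis `h` says
-- that the linear clock `d * e` gives the same verdict at each hit.
theorem hitCount_eq_hitCount_firstReturnMap {s U : Set X} (hU : U ⊆ s) {J : Set ℝ} {E : Finset ℝ}
    (hJ : IsStepSet J E) {c d : ℝ} (hc : 0 < c) (hd : 0 < d) {x : X} (hx : x ∈ s)
    (hinf : {n : ℕ | f^[n] x ∈ s}.Infinite)
    (h : ∀ j : ℕ, (firstReturnMap f s)^[j] x ∈ U → ∀ e ∈ E,
      (Nat.count (fun n => f^[n] x ∈ s) ⌈c * e⌉₊ ≤ j ↔ d * e ≤ j)) :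
    hitCount f U (c • J) x = hitCount (firstReturnMap f s) U (d • J) x := by
  set p : ℕ → Prop := fun n => f^[n] x ∈ s with hp
  have hstep : ∀ j : ℕ, (firstReturnMap f s)^[j] x ∈ U →
      ((Nat.nth p j : ℝ) ∈ c • J ↔ (j : ℝ) ∈ d • J) := by
    intro j hj
    rw [mem_smul_set_iff_inv_smul_mem₀ hc.ne', mem_smul_set_iff_inv_smul_mem₀ hd.ne']
    refine hJ.2 _ _ fun e he => ?_
    simp only [smul_eq_mul]
    rw [le_inv_mul_iff₀ hc, le_inv_mul_iff₀ hd, ← h j hj e he, ← Nat.ceil_le,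
      Nat.count_le_iff_le_nth hinf]
  have key : {i : ℕ | (i : ℝ) ∈ c • J ∧ f^[i] x ∈ U} =
      Nat.nth p '' {j : ℕ | (j : ℝ) ∈ d • J ∧ (firstReturnMap f s)^[j] x ∈ U} := by
    ext i
    constructor
    · rintro ⟨h1, h2⟩
      have hi : Nat.nth p (Nat.count p i) = i := Nat.nth_count (p := p) (hU h2)
      have h3 : (firstReturnMap f s)^[Nat.count p i] x ∈ U := by
        rw [iterate_firstReturnMap hx hinf, hi]
        exact h2
      refine ⟨Nat.count p i, ⟨(hstep _ h3).1 ?_, h3⟩, hi⟩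
      rwa [hi]
    · rintro ⟨j, ⟨h1, h2⟩, rfl⟩
      refine ⟨(hstep j h2).2 h1, ?_⟩
      rwa [iterate_firstReturnMap hx hinf] at h2
  rw [hitCount, hitCount, key, (Nat.nth_injective hinf).encard_image]

end HitCount

/-! ### Asymptotic independence of almost invariant events -/

section Comparison

open Classical in
theorem birkhoffSum_indicator_one_eq_count {X : Type*} (f : X → X) (s : Set X) (n : ℕ) (x : X) :
    birkhoffSum f (s.indicator (1 : X → ℝ)) n x = Nat.count (fun k => f^[k] x ∈ s) n := by
  induction n with
  | zero => simp
  | succ n ih =>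
    rw [birkhoffSum_succ, ih, Nat.count_succ]
    by_cases h : f^[n] x ∈ s <;> simp [h]

variable {X : Type*} [MeasurableSpace X] {μ : Measure X} {f : X → X}

theorem abs_measureReal_sub_measureReal_le {ν : Measure X} [IsFiniteMeasure ν] {A B C : Set X}
    (h : ∀ᵐ x ∂ν, x ∉ C → (x ∈ A ↔ x ∈ B)) : |ν.real A - ν.real B| ≤ ν.real C := by
  have aux : ∀ A B : Set X, (∀ᵐ x ∂ν, x ∉ C → (x ∈ A ↔ x ∈ B)) →
      ν.real A ≤ ν.real B + ν.real C := by
    intro A B h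
    refine le_trans ?_ (measureReal_union_le B C)
    refine ENNReal.toReal_mono (measure_ne_top _ _) (measure_mono_ae ?_)
    filter_upwards [h] with x hx hA
    by_cases hC : x ∈ C
    · exact Or.inr hC
    · exact Or.inl ((hx hC).1 hA)
  have h1 := aux A B h
  have h2 := aux B A (h.mono fun x hx hC => (hx hC).symm)
  rw [abs_le]
  constructor <;> linarith

/-- `D` is invariant up to `B`, so `s` may be replaced by the average of `n` of its preimages at
cost `n * μ.real B`; that average is close to `μ.real s` in `L¹`. -/
theorem abs_measureReal_inter_sub_mul_le [IsProbabilityMeasure μ] (hf : MeasurePreserving f μ μ)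
    {D B s : Set X} (hD : MeasurableSet D) (hs : MeasurableSet s)
    (hB : ∀ x, x ∉ B → (f x ∈ D ↔ x ∈ D)) {n : ℕ} (hn : n ≠ 0) :
    |μ.real (D ∩ s) - μ.real D * μ.real s| ≤ n * μ.real B +
      ∫ x, |birkhoffAverage ℝ f (s.indicator 1) n x - μ.real s| ∂μ := by
  have hn0 : (0 : ℝ) < n := by exact_mod_cast Nat.pos_of_ne_zero hn
  have hshift : ∀ k : ℕ, |μ.real (D ∩ s) - μ.real (D ∩ f^[k] ⁻¹' s)| ≤ k * μ.real B := by
    intro k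
    induction k with
    | zero => simp
    | succ k ih =>
      have h1 : μ.real (D ∩ f^[k] ⁻¹' s) = μ.real (f ⁻¹' D ∩ f^[k + 1] ⁻¹' s) := by
        have hm : MeasurableSet (D ∩ f^[k] ⁻¹' s) := hD.inter ((hf.iterate k).measurable hs)
        rw [measureReal_def, measureReal_def, ← hf.measure_preimage hm.nullMeasurableSet]
        rfl
      have h2 : |μ.real (f ⁻¹' D ∩ f^[k + 1] ⁻¹' s) - μ.real (D ∩ f^[k + 1] ⁻¹' s)| ≤ μ.real B :=
        abs_measureReal_sub_measureReal_le (Eventually.of_forall fun x hx =>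
          and_congr_left fun _ => hB x hx)
      have h3 := abs_sub_le (μ.real (D ∩ s)) (μ.real (D ∩ f^[k] ⁻¹' s))
        (μ.real (D ∩ f^[k + 1] ⁻¹' s))
      rw [← h1] at h2
      push_cast
      linarith
  have hint : ∀ k : ℕ, Integrable (fun x => s.indicator (1 : X → ℝ) (f^[k] x)) μ := by
    intro k
    exact (hf.iterate k).integrable_comp_of_integrable
      ((integrable_indicator_iff hs).2 (integrableOn_const (by simp)))
  have havg : ∫ x in D, birkhoffAverage ℝ f (s.indicator 1) n x ∂μ =
      (n : ℝ)⁻¹ * ∑ k ∈ Finset.range n, μ.real (D ∩ f^[k] ⁻¹' s) := by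
    simp only [birkhoffAverage, birkhoffSum, smul_eq_mul]
    rw [integral_const_mul, integral_finsetSum _ fun k _ => (hint k).integrableOn]
    congr 1
    refine Finset.sum_congr rfl fun k _ => ?_
    have : (fun x => s.indicator (1 : X → ℝ) (f^[k] x)) = (f^[k] ⁻¹' s).indicator 1 := rfl
    rw [this, integral_indicator_one ((hf.iterate k).measurable hs),
      measureReal_restrict_apply ((hf.iterate k).measurable hs), inter_comm]
  have hAint : Integrable (fun x => birkhoffAverage ℝ f (s.indicator (1 : X → ℝ)) n x) μ := by
    simp only [birkhoffAverage, birkhoffSum, smul_eq_mul]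
    exact (integrable_finsetSum _ fun k _ => hint k).const_mul _
  have hA2 : Integrable
      (fun x => birkhoffAverage ℝ f (s.indicator (1 : X → ℝ)) n x - μ.real s) μ :=
    hAint.sub (integrable_const _)
  have h1 : |μ.real (D ∩ s) - ∫ x in D, birkhoffAverage ℝ f (s.indicator 1) n x ∂μ| ≤
      n * μ.real B := by
    have : μ.real (D ∩ s) - ∫ x in D, birkhoffAverage ℝ f (s.indicator 1) n x ∂μ =
        (n : ℝ)⁻¹ * ∑ k ∈ Finset.range n, (μ.real (D ∩ s) - μ.real (D ∩ f^[k] ⁻¹' s)) := by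
      rw [havg, Finset.sum_sub_distrib, mul_sub]
      simp [hn0.ne']
    rw [this, abs_mul, abs_of_pos (inv_pos.2 hn0), inv_mul_le_iff₀ hn0]
    refine (Finset.abs_sum_le_sum_abs _ _).trans ?_
    refine (Finset.sum_le_card_nsmul _ _ (n * μ.real B) fun k hk => (hshift k).trans ?_).trans ?_
    · gcongr
      exact (Finset.mem_range.1 hk).le
    · simp
  have h2 : |(∫ x in D, birkhoffAverage ℝ f (s.indicator 1) n x ∂μ) - μ.real D * μ.real s| ≤
      ∫ x, |birkhoffAverage ℝ f (s.indicator 1) n x - μ.real s| ∂μ := by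
    have : (∫ x in D, birkhoffAverage ℝ f (s.indicator 1) n x ∂μ) - μ.real D * μ.real s =
        ∫ x in D, (birkhoffAverage ℝ f (s.indicator 1) n x - μ.real s) ∂μ := by
      rw [integral_sub hAint.integrableOn (integrable_const _)]
      simp
    rw [this]
    exact abs_integral_le_integral_abs.trans
      (setIntegral_le_integral hA2.abs (Eventually.of_forall fun x => abs_nonneg _))
  have h3 := abs_sub_le (μ.real (D ∩ s)) (∫ x in D, birkhoffAverage ℝ f (s.indicator 1) n x ∂μ)
    (μ.real D * μ.real s)
  linarith

theorem tendsto_integral_abs_birkhoffAverage_indicator_sub [IsProbabilityMeasure μ]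
    (hf : Ergodic f μ) {s : Set X} (hs : MeasurableSet s) :
    Tendsto (fun n : ℕ => ∫ x, |birkhoffAverage ℝ f (s.indicator 1) n x - μ.real s| ∂μ)
      atTop (𝓝 0) := by
  have := tendsto_integral_abs_birkhoffAverage_sub hf (g := s.indicator (1 : X → ℝ))
    ((memLp_const (1 : ℝ)).indicator hs)
  rwa [integral_indicator_one hs] at this

open Classical in
/-- The number of visits to `s` before time `c e` is `c e μ(s) + o(c)`, in probability. -/
theorem exists_forall_measureReal_count_le [IsProbabilityMeasure μ] (hf : Ergodic f μ) {s : Set X}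
    (hs : MeasurableSet s) {e : ℝ} (he : 0 ≤ e) {ε η : ℝ} (hε : 0 < ε) (hη : 0 < η) :
    ∃ c₀ : ℝ, ∀ c ≥ c₀, μ.real {x | ε * c <
      |(Nat.count (fun k => f^[k] x ∈ s) ⌈c * e⌉₊ : ℝ) - μ.real s * c * e|} ≤ η := by
  rcases he.eq_or_lt with rfl | he
  · refine ⟨0, fun c hc => ?_⟩
    have : {x | ε * c < |(Nat.count (fun k => f^[k] x ∈ s) ⌈c * 0⌉₊ : ℝ) - μ.real s * c * 0|} =
        ∅ := by
      ext x
      simp only [mem_ofPred_eq, mem_empty_iff_false, iff_false, not_lt, mul_zero, Nat.ceil_zero,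
        Nat.count_zero, Nat.cast_zero, sub_zero, abs_zero]
      exact mul_nonneg hε.le hc
    rw [this]
    simpa using hη.le
  -- tolerance for the ergodic averages
  set θ : ℝ := ε / (2 * (e + 1)) with hθ
  have hθ0 : 0 < θ := by positivity
  have hlim := tendsto_integral_abs_birkhoffAverage_indicator_sub hf hs
  obtain ⟨N, hN⟩ := eventually_atTop.1 (hlim.eventually (gt_mem_nhds (mul_pos hθ0 hη)))
  -- `c ≥ 1` gives `n ≤ c * (e + 1)`, `c ≥ 2 / ε` absorbs the rounding error `1` into `ε * c / 2`,
  -- and the last bound gives `n ≥ N`.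
  refine ⟨max (max 1 (2 / ε)) ((N + 1) / e), fun c hc => ?_⟩
  have hc1 : 1 ≤ c := (le_max_left _ _).trans ((le_max_left _ _).trans hc)
  have hc2 : 2 / ε ≤ c := (le_max_right _ _).trans ((le_max_left _ _).trans hc)
  have hc3 : (N + 1) / e ≤ c := (le_max_right _ _).trans hc
  rw [div_le_iff₀ hε] at hc2
  rw [div_le_iff₀ he] at hc3
  set n := ⌈c * e⌉₊ with hn
  have hn1 : c * e ≤ n := Nat.le_ceil _
  have hn2 : (n : ℝ) < c * e + 1 := Nat.ceil_lt_add_one (by positivity)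
  have hn0 : (0 : ℝ) < n := by linarith [N.cast_nonneg (α := ℝ)]
  have hNn : N ≤ n := by
    have : (N : ℝ) ≤ n := by linarith
    exact_mod_cast this
  have hs1 : μ.real s ≤ 1 := measureReal_le_one
  have hs0 : 0 ≤ μ.real s := measureReal_nonneg
  have hmp := hf.toMeasurePreserving
  have hAint : Integrable (fun x => birkhoffAverage ℝ f (s.indicator (1 : X → ℝ)) n x) μ := by
    simp only [birkhoffAverage, birkhoffSum, smul_eq_mul]
    refine (integrable_finsetSum _ fun k _ => ?_).const_mul _
    exact (hmp.iterate k).integrable_comp_of_integrable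
      ((integrable_indicator_iff hs).2 (integrableOn_const (by simp)))
  have hmarkov := mul_meas_ge_le_integral_of_nonneg (μ := μ)
    (f := fun x => |birkhoffAverage ℝ f (s.indicator (1 : X → ℝ)) n x - μ.real s|)
    (Eventually.of_forall fun x => abs_nonneg _) (hAint.sub (integrable_const _)).abs θ
  have hle : μ.real {x | ε * c < |(Nat.count (fun k => f^[k] x ∈ s) n : ℝ) - μ.real s * c * e|} ≤
      μ.real {x | θ ≤ |birkhoffAverage ℝ f (s.indicator (1 : X → ℝ)) n x - μ.real s|} := by
    refine measureReal_mono fun x hx => ?_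
    simp only [mem_ofPred_eq] at hx ⊢
    rw [birkhoffAverage, birkhoffSum_indicator_one_eq_count, smul_eq_mul]
    set S : ℝ := (Nat.count (fun k => f^[k] x ∈ s) n : ℝ) with hS
    have h1 : (n : ℝ)⁻¹ * S - μ.real s = (n : ℝ)⁻¹ * (S - n * μ.real s) := by field_simp
    rw [h1, abs_mul, abs_of_pos (inv_pos.2 hn0), le_inv_mul_iff₀ hn0]
    have h2 : |n * μ.real s - μ.real s * c * e| ≤ 1 := by
      have : n * μ.real s - μ.real s * c * e = μ.real s * (n - c * e) := by ring
      rw [this, abs_mul, abs_of_nonneg hs0, abs_of_nonneg (by linarith)]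
      nlinarith
    have h3 := abs_sub_le S (n * μ.real s) (μ.real s * c * e)
    have h4 : n * θ ≤ ε * c / 2 := by
      have : (n : ℝ) ≤ c * (e + 1) := by nlinarith
      calc n * θ ≤ c * (e + 1) * θ := by gcongr
        _ = ε * c / 2 := by rw [hθ]; field_simp
    linarith
  refine hle.trans ?_
  have := hmarkov.trans (hN n hNn).le
  exact le_of_mul_le_mul_left this hθ0

end Comparison

/-! ### Comparison of the counts of a system and of its induced system -/

section Induced

variable {X : Type*} [MeasurableSpace X]

/-- Union bound over the at most `2 * r + 1` natural numbers in the window, using invariance. -/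
theorem measureReal_exists_hit_near_le {ν : Measure X} [IsFiniteMeasure ν] {T : X → X}
    (hT : MeasurePreserving T ν ν) {U : Set X} (hU : MeasurableSet U) (a : ℝ) {r : ℝ}
    (hr : 0 ≤ r) :
    ν.real {x | ∃ j : ℕ, |(j : ℝ) - a| ≤ r ∧ T^[j] x ∈ U} ≤ (2 * r + 1) * ν.real U := by
  by_cases har : a + r < 0
  · have : {x | ∃ j : ℕ, |(j : ℝ) - a| ≤ r ∧ T^[j] x ∈ U} = ∅ := by
      ext x
      simp only [mem_ofPred_eq, mem_empty_iff_false, iff_false, not_exists, not_and]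
      intro j hj
      rw [abs_le] at hj
      linarith [j.cast_nonneg (α := ℝ)]
    rw [this, measureReal_empty]
    positivity
  have hsub : {x | ∃ j : ℕ, |(j : ℝ) - a| ≤ r ∧ T^[j] x ∈ U} ⊆
      ⋃ j ∈ Finset.Icc ⌈a - r⌉₊ ⌊a + r⌋₊, T^[j] ⁻¹' U := by
    rintro x ⟨j, hj, hx⟩
    rw [abs_le] at hj
    simp only [mem_iUnion, Finset.mem_Icc, exists_prop]
    exact ⟨j, ⟨Nat.ceil_le.2 (by linarith), Nat.le_floor (by linarith)⟩, hx⟩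
  have hcard : ((Finset.Icc ⌈a - r⌉₊ ⌊a + r⌋₊).card : ℝ) ≤ 2 * r + 1 := by
    rw [Nat.card_Icc]
    rcases le_total ⌈a - r⌉₊ (⌊a + r⌋₊ + 1) with h | h
    · rw [Nat.cast_sub h]
      push_cast
      linarith [Nat.floor_le (not_lt.1 har), Nat.le_ceil (a - r)]
    · rw [Nat.sub_eq_zero_of_le h]
      push_cast
      linarith
  refine (measureReal_mono hsub (measure_ne_top _ _)).trans ((measureReal_biUnion_finset_le _ _).trans ?_)
  have : ∀ j ∈ Finset.Icc ⌈a - r⌉₊ ⌊a + r⌋₊, ν.real (T^[j] ⁻¹' U) = ν.real U := fun j _ => by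
    rw [measureReal_def, (hT.iterate j).measure_preimage hU.nullMeasurableSet, measureReal_def]
  rw [Finset.sum_congr rfl this, Finset.sum_const, nsmul_eq_mul]
  gcongr

variable {μ : Measure X} {f : X → X}

theorem measureReal_cond_eq {s : Set X} (hs : MeasurableSet s) (A : Set X) :
    (ProbabilityTheory.cond μ s).real A = μ.real (A ∩ s) / μ.real s := by
  rw [measureReal_def, ProbabilityTheory.cond_apply hs, ENNReal.toReal_mul, ENNReal.toReal_inv,
    inter_comm, div_eq_inv_mul]
  rfl

/-- Under the conditional measure, a rare set `U ⊆ s` is hit as often by the orbits of `f` as by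
the orbits of the first return map, on the respective time scales. -/
theorem exists_forall_abs_hitCount_firstReturnMap_sub_le [IsProbabilityMeasure μ]
    (hf : Ergodic f μ) {s : Set X} (hs : MeasurableSet s) (hs0 : μ s ≠ 0)
    (hT : MeasurePreserving (firstReturnMap f s) (ProbabilityTheory.cond μ s)
      (ProbabilityTheory.cond μ s)) {J : Set ℝ} {E : Finset ℝ} (hJ : IsStepSet J E) {ε : ℝ}
    (hε : 0 < ε) :
    ∃ η > 0, ∀ U ⊆ s, MeasurableSet U → 0 < μ.real U → μ.real U < η → ∀ κ : ℕ,
      |(ProbabilityTheory.cond μ s).real {x | hitCount f U ((1 / μ.real U) • J) x ≤ κ} -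
        (ProbabilityTheory.cond μ s).real {x | hitCount (firstReturnMap f s) U
          ((1 / (ProbabilityTheory.cond μ s).real U) • J) x ≤ κ}| ≤ ε := by
  classical
  set ν := ProbabilityTheory.cond μ s with hν
  have hνp : IsProbabilityMeasure ν := ProbabilityTheory.cond_isProbabilityMeasure hs0
  set m := μ.real s with hm
  have hm0 : 0 < m := ENNReal.toReal_pos hs0 (measure_ne_top _ _)
  set k : ℝ := (E.card : ℝ) with hk
  have hk0 : 0 ≤ k := Nat.cast_nonneg _
  -- With `η₁` below, each endpoint contributes `η₁ / m + 4 * ε₁ / m = ε / (k + 1)`.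
  set ε₁ : ℝ := ε * m / (8 * (k + 1)) with hε₁
  have hε₁0 : 0 < ε₁ := by positivity
  set η₁ : ℝ := ε * m / (2 * (k + 1)) with hη₁
  have hη₁0 : 0 < η₁ := by positivity
  have hev : ∀ᶠ c : ℝ in atTop, ∀ e ∈ E, μ.real {x | ε₁ * c <
      |(Nat.count (fun k => f^[k] x ∈ s) ⌈c * e⌉₊ : ℝ) - m * c * e|} ≤ η₁ := by
    refine (eventually_all_finset E).2 fun e he => eventually_atTop.2 ?_
    exact exists_forall_measureReal_count_le hf hs (hJ.1 e he) hε₁0 hη₁0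
  obtain ⟨c₀, hc₀⟩ := eventually_atTop.1 hev
  -- The first bound controls the `+ 1` in the window estimate; the second forces `1 / μ.real U ≥
  -- c₀`.
  refine ⟨min (2 * ε₁) (1 / (|c₀| + 1)), by positivity, fun U hUs hU hU0 hUη κ => ?_⟩
  set t := μ.real U with ht
  have ht1 : t < 2 * ε₁ := hUη.trans_le (min_le_left _ _)
  have ht2 : t < 1 / (|c₀| + 1) := hUη.trans_le (min_le_right _ _)
  set c : ℝ := 1 / t with hc
  have hc0 : 0 < c := by positivity
  have hcc₀ : c₀ ≤ c := by
    rw [hc, le_div_iff₀ hU0]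
    rw [lt_div_iff₀ (by positivity)] at ht2
    nlinarith [le_abs_self c₀]
  have hνU : ν.real U = t / m := by
    rw [measureReal_cond_eq hs, inter_eq_self_of_subset_left hUs]
  have hd : 1 / ν.real U = m * c := by rw [hνU, hc]; field_simp
  have hd0 : 0 < m * c := by positivity
  rw [hd]
  set B₁ : ℝ → Set X := fun e => {x | ε₁ * c <
      |(Nat.count (fun k => f^[k] x ∈ s) ⌈c * e⌉₊ : ℝ) - m * c * e|} with hB₁
  set B₂ : ℝ → Set X := fun e => {x | ∃ j : ℕ, |(j : ℝ) - m * c * e| ≤ ε₁ * c ∧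
      (firstReturnMap f s)^[j] x ∈ U} with hB₂
  -- Poincaré recurrence.
  have hrec : ∀ᵐ x ∂ν, x ∈ s ∧ {n : ℕ | f^[n] x ∈ s}.Infinite := by
    have h1 : ∀ᵐ x ∂ν, x ∈ s := ProbabilityTheory.ae_cond_mem hs
    have h2 := (ProbabilityTheory.cond_absolutelyContinuous (μ := μ) (s := s)).ae_le
      (hf.toMeasurePreserving.conservative.ae_mem_imp_frequently_image_mem
        hs.nullMeasurableSet)
    filter_upwards [h1, h2] with x hx hx2
    exact ⟨hx, Nat.frequently_atTop_iff_infinite.1 (hx2 hx)⟩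
  have hmain := abs_measureReal_sub_measureReal_le (ν := ν)
    (A := {x | hitCount f U (c • J) x ≤ κ})
    (B := {x | hitCount (firstReturnMap f s) U ((m * c) • J) x ≤ κ})
    (C := ⋃ e ∈ E, (B₁ e ∪ B₂ e)) (by
      filter_upwards [hrec] with x hx hxB
      simp only [mem_iUnion, exists_prop, not_exists, not_and, mem_union, not_or] at hxB
      rw [hitCount_eq_hitCount_firstReturnMap hUs hJ hc0 hd0 hx.1 hx.2]
      intro j hj e he
      obtain ⟨h1, h2⟩ := hxB e he
      simp only [hB₁, hB₂, mem_ofPred_eq, not_lt, not_exists, not_and] at h1 h2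
      have h3 : ¬ |(j : ℝ) - m * c * e| ≤ ε₁ * c := fun h => h2 j h hj
      rw [abs_le] at h1
      -- If `j` separates the visit count from `m * c * e`, it lies within `ε₁ * c` of the latter,
      -- which `h3` forbids.
      constructor
      · intro h
        have h' : (Nat.count (fun k => f^[k] x ∈ s) ⌈c * e⌉₊ : ℝ) ≤ j := by exact_mod_cast h
        by_contra! hlt
        exact h3 (abs_le.2 ⟨by linarith [h1.1], by nlinarith⟩)
      · intro h
        by_contra! hlt
        have h' : (j : ℝ) ≤ (Nat.count (fun k => f^[k] x ∈ s) ⌈c * e⌉₊ : ℝ) := by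
          exact_mod_cast hlt.le
        exact h3 (abs_le.2 ⟨by nlinarith, by linarith [h1.2]⟩))
  refine hmain.trans ((measureReal_biUnion_finset_le _ _).trans ?_)
  have hbound : ∀ e ∈ E, ν.real (B₁ e ∪ B₂ e) ≤ η₁ / m + 4 * ε₁ / m := by
    intro e he
    refine (measureReal_union_le _ _).trans (add_le_add ?_ ?_)
    · rw [measureReal_cond_eq hs]
      gcongr
      exact (measureReal_mono inter_subset_left).trans (hc₀ c hcc₀ e he)
    · refine (measureReal_exists_hit_near_le hT hU _ (by positivity)).trans ?_
      rw [hνU]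
      have : (2 * (ε₁ * c) + 1) * (t / m) = (2 * ε₁ + t) / m := by
        rw [hc]; field_simp
      rw [this]
      gcongr
      linarith
  refine (Finset.sum_le_card_nsmul _ _ _ hbound).trans ?_
  rw [nsmul_eq_mul, ← hk]
  have : η₁ / m + 4 * ε₁ / m = ε / (k + 1) := by
    rw [hη₁, hε₁]; field_simp; ring
  rw [this, mul_div_assoc', div_le_iff₀ (by positivity)]
  nlinarith

/-- The number of hits of a rare set has asymptotically the same distribution with respect to `μ`
and to the conditional measure on `s`. -/
theorem exists_forall_abs_hitCount_cond_sub_le [IsProbabilityMeasure μ]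
    (hf : Ergodic f μ) {s : Set X} (hs : MeasurableSet s) (hs0 : μ s ≠ 0) {J : Set ℝ}
    {E : Finset ℝ} (hJ : IsStepSet J E) {ε : ℝ} (hε : 0 < ε) :
    ∃ η > 0, ∀ U : Set X, MeasurableSet U → μ.real U < η → ∀ c : ℝ, 0 < c → ∀ κ : ℕ,
      |μ.real {x | hitCount f U (c • J) x ≤ κ} -
        (ProbabilityTheory.cond μ s).real {x | hitCount f U (c • J) x ≤ κ}| ≤ ε := by
  have hmp := hf.toMeasurePreserving
  set m := μ.real s with hm
  have hm0 : 0 < m := ENNReal.toReal_pos hs0 (measure_ne_top _ _)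
  set k : ℝ := (E.card : ℝ) with hk
  have hk0 : 0 ≤ k := Nat.cast_nonneg _
  -- The averaging length `n` depends only on `s` and `ε`; `U` is then taken small relative to `1 /
  -- n`.
  obtain ⟨n, hn, hn0⟩ := (((tendsto_integral_abs_birkhoffAverage_indicator_sub hf hs).eventually
    (gt_mem_nhds (show 0 < ε * m / 2 by positivity))).and (eventually_ne_atTop 0)).exists
  have hn1 : (0 : ℝ) < n := by exact_mod_cast Nat.pos_of_ne_zero hn0
  refine ⟨ε * m / (2 * (n * (k + 1))), by positivity, fun U hU hUη c hc κ => ?_⟩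
  set D := {x | hitCount f U (c • J) x ≤ κ} with hD
  have h := abs_measureReal_inter_sub_mul_le hmp
    (measurableSet_hitCount_le hmp.measurable hU (c • J) κ) hs
    (B := U ∪ ⋃ e ∈ E, f^[⌈c * e⌉₊] ⁻¹' U) (fun x hx => by
      simp only [mem_union, mem_iUnion, exists_prop, not_or, not_exists, not_and] at hx
      simp only [mem_ofPred_eq]
      rw [hitCount_comp_self hJ hc hx.1 hx.2]) hn0
  have hB : μ.real (U ∪ ⋃ e ∈ E, f^[⌈c * e⌉₊] ⁻¹' U) ≤ (k + 1) * μ.real U := by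
    refine (measureReal_union_le _ _).trans ?_
    have h1 : μ.real (⋃ e ∈ E, f^[⌈c * e⌉₊] ⁻¹' U) ≤ k * μ.real U := by
      refine (measureReal_biUnion_finset_le _ _).trans (le_of_eq ?_)
      have : ∀ e ∈ E, μ.real (f^[⌈c * e⌉₊] ⁻¹' U) = μ.real U := fun e _ => by
        rw [measureReal_def, (hmp.iterate _).measure_preimage hU.nullMeasurableSet,
          measureReal_def]
      rw [Finset.sum_congr rfl this, Finset.sum_const, nsmul_eq_mul]
    linarith
  have hnB : n * μ.real (U ∪ ⋃ e ∈ E, f^[⌈c * e⌉₊] ⁻¹' U) ≤ ε * m / 2 := by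
    rw [lt_div_iff₀ (by positivity)] at hUη
    nlinarith
  rw [measureReal_cond_eq hs, abs_sub_comm]
  have h2 : μ.real (D ∩ s) / m - μ.real D = (μ.real (D ∩ s) - μ.real D * m) / m := by
    field_simp
  rw [h2, abs_div, abs_of_pos hm0, div_le_iff₀ hm0]
  linarith

/-- The laws of the numbers of hits of a rare set `U ⊆ s`, for an ergodic map and for its first
return map to `s`, are close when `U` is small. -/
theorem exists_forall_abs_hitCount_sub_le [IsProbabilityMeasure μ]
    (hf : Ergodic f μ) {s : Set X} (hs : MeasurableSet s) (hs0 : μ s ≠ 0)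
    (hT : MeasurePreserving (firstReturnMap f s) (ProbabilityTheory.cond μ s)
      (ProbabilityTheory.cond μ s)) {J : Set ℝ} {E : Finset ℝ} (hJ : IsStepSet J E) {ε : ℝ}
    (hε : 0 < ε) :
    ∃ η > 0, ∀ U ⊆ s, MeasurableSet U → μ.real U < η → ∀ κ : ℕ,
      |μ.real {x | hitCount f U ((1 / μ.real U) • J) x ≤ κ} -
        (ProbabilityTheory.cond μ s).real {x | hitCount (firstReturnMap f s) U
          ((1 / (ProbabilityTheory.cond μ s).real U) • J) x ≤ κ}| ≤ ε := by
  obtain ⟨η₁, hη₁, h₁⟩ := exists_forall_abs_hitCount_cond_sub_le hf hs hs0 hJ (half_pos hε)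
  obtain ⟨η₂, hη₂, h₂⟩ :=
    exists_forall_abs_hitCount_firstReturnMap_sub_le hf hs hs0 hT hJ (half_pos hε)
  refine ⟨min η₁ η₂, lt_min hη₁ hη₂, fun U hUs hU hUη κ => ?_⟩
  -- For null `U` the normalisation `1 / 0 = 0` is degenerate, but there are almost surely no hits,
  -- so both probabilities are `1`.
  rcases eq_or_ne (μ U) 0 with h0 | h0
  · have : IsProbabilityMeasure (ProbabilityTheory.cond μ s) :=
      ProbabilityTheory.cond_isProbabilityMeasure hs0
    rw [measureReal_hitCount_le_eq_one hf.toMeasurePreserving hU h0,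
      measureReal_hitCount_le_eq_one hT hU (ProbabilityTheory.cond_absolutelyContinuous h0)]
    simpa using hε.le
  · have ht : 0 < μ.real U := ENNReal.toReal_pos h0 (measure_ne_top _ _)
    have h3 := h₁ U hU (hUη.trans_le (min_le_left _ _)) (1 / μ.real U) (by positivity) κ
    have h4 := h₂ U hUs hU ht (hUη.trans_le (min_le_right _ _)) κ
    exact (abs_sub_le _ _ _).trans ((add_le_add h3 h4).trans (add_halves ε).le)

end Induced

/-! ### Levels below the maximum -/

theorem eventually_levelFilter_of_lt {uF : EReal} {a : ℝ} (ha : (a : EReal) < uF) :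
    ∀ᶠ u : ℝ in levelFilter uF, a < u ∧ (u : EReal) < uF := by
  have h : Ioo (a : EReal) uF ∈ 𝓝[<] uF := Ioo_mem_nhdsLT ha
  filter_upwards [preimage_mem_comap h] with u hu
  exact ⟨EReal.coe_lt_coe_iff.1 hu.1, hu.2⟩

theorem exists_lt_of_eventually_levelFilter {uF : EReal} {p : ℝ → Prop} {u₁ : ℝ}
    (hu₁ : (u₁ : EReal) < uF) (h : ∀ᶠ u in levelFilter uF, p u) :
    ∃ a : ℝ, (a : EReal) < uF ∧ ∀ u : ℝ, a < u → (u : EReal) < uF → p u := by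
  obtain ⟨t, ht, hsub⟩ := mem_comap.1 h
  obtain ⟨l, hl, hlt⟩ := (mem_nhdsLT_iff_exists_Ioo_subset' hu₁).1 ht
  obtain ⟨a, hla, ha⟩ := EReal.lt_iff_exists_real_btwn.1 hl
  exact ⟨a, ha, fun u hau huF =>
    hsub (hlt ⟨hla.trans (EReal.coe_lt_coe_iff.2 hau), huF⟩)⟩

/-- Added to a monotone bound, such a function makes it positive and the estimate strict. At `⊥` the
filter is trivial. -/
theorem exists_pos_antitoneOn_tendsto_levelFilter (uF : EReal) :
    ∃ e : ℝ → ℝ, (∀ u : ℝ, (u : EReal) < uF → 0 < e u) ∧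
      AntitoneOn e {u : ℝ | (u : EReal) < uF} ∧ Tendsto e (levelFilter uF) (𝓝 0) := by
  induction uF with
  | bot =>
    refine ⟨fun _ => 1, fun u hu => absurd hu not_lt_bot, fun u _ v _ _ => le_rfl, ?_⟩
    have : levelFilter ⊥ = ⊥ := by
      have h : (𝓝[<] (⊥ : EReal)) = ⊥ := by simp
      rw [levelFilter, h, comap_bot]
    rw [this]
    exact tendsto_bot
  | coe r =>
    refine ⟨fun u => r - u, fun u hu => sub_pos.2 (EReal.coe_lt_coe_iff.1 hu),
      fun u _ v _ huv => sub_le_sub_left huv r, ?_⟩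
    rw [Metric.tendsto_nhds]
    intro ε hε
    filter_upwards [eventually_levelFilter_of_lt (uF := r) (a := r - ε)
      (EReal.coe_lt_coe_iff.2 (by linarith))] with u hu
    have := EReal.coe_lt_coe_iff.1 hu.2
    rw [Real.dist_eq, sub_zero, abs_of_pos (by linarith)]
    linarith [hu.1]
  | top =>
    refine ⟨fun u => Real.exp (-u), fun u _ => Real.exp_pos _,
      fun u _ v _ huv => Real.exp_le_exp.2 (neg_le_neg huv), ?_⟩
    rw [Metric.tendsto_nhds]
    intro ε hε
    filter_upwards [eventually_levelFilter_of_lt (uF := ⊤) (a := -Real.log ε)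
      (EReal.coe_lt_top _)] with u hu
    rw [Real.dist_eq, sub_zero, abs_of_pos (Real.exp_pos _), ← Real.lt_log_iff_exp_lt hε]
    linarith [hu.1]

/-- A bounded family that tends to `0` uniformly as `u ↗ uF` is dominated by a positive
non-increasing function of `u` that tends to `0`. -/
theorem exists_antitoneOn_bound {ι : Type*} [Nonempty ι] {uF : EReal} {D : ℝ → ι → ℝ} {M : ℝ}
    (hD0 : ∀ u i, 0 ≤ D u i) (hDM : ∀ u i, D u i ≤ M)
    (hD : ∀ ε > 0, ∀ᶠ u in levelFilter uF, ∀ i, D u i ≤ ε) :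
    ∃ δ : ℝ → ℝ, (∀ u : ℝ, (u : EReal) < uF → 0 < δ u) ∧
      AntitoneOn δ {u : ℝ | (u : EReal) < uF} ∧ Tendsto δ (levelFilter uF) (𝓝 0) ∧
      ∀ u : ℝ, (u : EReal) < uF → ∀ i, D u i < δ u := by
  obtain ⟨e, he0, hea, het⟩ := exists_pos_antitoneOn_tendsto_levelFilter uF
  -- All errors at levels `u` or higher: these sets shrink as `u` grows, so their suprema are
  -- non-increasing.
  let S : ℝ → Set ℝ := fun u => {y | ∃ w : ℝ, u ≤ w ∧ (w : EReal) < uF ∧ ∃ i, y = D w i}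
  have hbdd : ∀ u, BddAbove (S u) := fun u => ⟨M, by rintro y ⟨w, _, _, i, rfl⟩; exact hDM w i⟩
  have hmem : ∀ u : ℝ, (u : EReal) < uF → ∀ i, D u i ∈ S u :=
    fun u hu i => ⟨u, le_rfl, hu, i, rfl⟩
  have hle : ∀ u : ℝ, (u : EReal) < uF → ∀ i, D u i ≤ sSup (S u) :=
    fun u hu i => le_csSup (hbdd u) (hmem u hu i)
  have hne : ∀ u : ℝ, (u : EReal) < uF → (S u).Nonempty :=
    fun u hu => ⟨_, hmem u hu (Classical.arbitrary ι)⟩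
  have hS0 : ∀ u, 0 ≤ sSup (S u) := fun u =>
    Real.sSup_nonneg (by rintro y ⟨w, _, _, i, rfl⟩; exact hD0 w i)
  refine ⟨fun u => sSup (S u) + e u, fun u hu => add_pos_of_nonneg_of_pos (hS0 u) (he0 u hu),
    fun u hu v hv huv => add_le_add (csSup_le_csSup (hbdd u) (hne v hv) ?_) (hea hu hv huv), ?_,
    fun u hu i => (hle u hu i).trans_lt (lt_add_of_pos_right _ (he0 u hu))⟩
  · rintro y ⟨w, hw, hwF, i, rfl⟩
    exact ⟨w, huv.trans hw, hwF, i, rfl⟩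
  · have hsup : Tendsto (fun u => sSup (S u)) (levelFilter uF) (𝓝 0) := by
      rw [Metric.tendsto_nhds]
      intro ε hε
      by_cases hlev : ∃ u₁ : ℝ, (u₁ : EReal) < uF
      · obtain ⟨u₁, hu₁⟩ := hlev
        obtain ⟨a, ha, hau⟩ := exists_lt_of_eventually_levelFilter hu₁ (hD (ε / 2) (half_pos hε))
        filter_upwards [eventually_levelFilter_of_lt ha] with u hu
        rw [Real.dist_eq, sub_zero, abs_of_nonneg (hS0 u)]
        refine lt_of_le_of_lt (csSup_le (hne u hu.2) ?_) (half_lt_self hε)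
        rintro y ⟨w, hw, hwF, i, rfl⟩
        exact hau w (hu.1.trans_le hw) hwF i
      · have : ∀ᶠ u : ℝ in levelFilter uF, (u : EReal) < uF :=
          preimage_mem_comap self_mem_nhdsWithin
        filter_upwards [this] with u hu
        exact absurd ⟨u, hu⟩ hlev
    simpa using hsup.add het

/-- Pointwise convergence of distribution functions on `ℕ` to a distribution function is
uniform. -/
theorem IsNatDistributionFunction.eventually_forall_abs_sub_le {ι : Type*} {l : Filter ι}
    {F : ι → ℕ → ℝ} {H : ℕ → ℝ} (hH : IsNatDistributionFunction H) (hmono : ∀ u, Monotone (F u))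
    (hF1 : ∀ u k, F u k ≤ 1) (hlim : ∀ k, Tendsto (fun u => F u k) l (𝓝 (H k))) {ε : ℝ}
    (hε : 0 < ε) : ∀ᶠ u in l, ∀ k, |F u k - H k| ≤ ε := by
  have hH1 : ∀ k, H k ≤ 1 := fun k => hH.2.1.ge_of_tendsto hH.2.2 k
  -- Beyond `K` monotonicity traps both functions between `1 - ε` and `1`; only finitely many `k`
  -- remain.
  obtain ⟨K, hK⟩ := (hH.2.2.eventually (lt_mem_nhds (show 1 - ε / 2 < 1 by linarith))).exists
  have hev : ∀ᶠ u in l, ∀ k ∈ Finset.range (K + 1), |F u k - H k| < ε / 2 :=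
    (eventually_all_finset _).2 fun k _ => by
      simpa [Real.dist_eq] using Metric.tendsto_nhds.1 (hlim k) (ε / 2) (half_pos hε)
  filter_upwards [hev] with u hu k
  rcases le_total k K with hk | hk
  · linarith [hu k (Finset.mem_range.2 (by omega))]
  · have h1 := abs_lt.1 (hu K (Finset.mem_range.2 (by omega)))
    have h2 := hmono u hk
    have h3 := hH.2.1 hk
    have h4 := hF1 u k
    have h5 := hH1 k
    rw [abs_le]
    constructor <;> linarith

/-- Nothing exceeds the maximum, so continuity of the measure at the level `ϕ ζ` gives the limit
`0`. -/
theorem CondR1.tendsto_measureReal_exceedanceSet {X : Type*} [TopologicalSpace X]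
    [MeasurableSpace X] {μ : Measure X} {ϕ : X → EReal} {ζ : X} (h : CondR1 μ ϕ ζ)
    (hmax : ∀ x, ϕ x ≤ ϕ ζ) :
    Tendsto (fun u : ℝ => μ.real (exceedanceSet ϕ (u : EReal))) (levelFilter (ϕ ζ)) (𝓝 0) := by
  obtain ⟨W, hW, hcont⟩ := h.2
  have h0 : μ (exceedanceSet ϕ (ϕ ζ)) = 0 := by
    have : exceedanceSet ϕ (ϕ ζ) = ∅ := by
      ext x
      simpa [exceedanceSet] using hmax x
    rw [this, measure_empty]
  have h1 : Tendsto (fun u : EReal => μ (exceedanceSet ϕ u)) (𝓝 (ϕ ζ)) (𝓝 0) := by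
    have := (hcont.continuousAt hW).tendsto
    rwa [h0] at this
  have h2 : Tendsto (fun u : ℝ => (u : EReal)) (levelFilter (ϕ ζ)) (𝓝 (ϕ ζ)) :=
    tendsto_comap.mono_right nhdsWithin_le_nhds
  exact (ENNReal.tendsto_toReal ENNReal.zero_ne_top).comp (h1.comp h2)

end RareEvents

theorem mainTheorem5 {X : Type*} [MetricSpace X] [MeasurableSpace X] [BorelSpace X]
    -- the system, with its ergodic invariant probability measure, and the observable
    (f : X → X) (hf : Measurable f)
    (μ : Measure X) [IsProbabilityMeasure μ] (hμ : Ergodic f μ)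
    (ϕ : X → EReal) (hϕ : Measurable ϕ)
    -- the periodic point of prime period `p`, at which the observable is maximal
    (ζ : X) (p : ℕ) (hp : 0 < p) (hζ : Function.minimalPeriod f ζ = p)
    (hmax : ∀ x, ϕ x ≤ ϕ ζ)
    (hR1 : RareEvents.CondR1 μ ϕ ζ)
    -- the inducing set
    (Xhat : Set X) (hXhat : MeasurableSet Xhat) (hζX : ζ ∈ Xhat)
    (hret : RareEvents.firstReturnTime f Xhat ζ = p)
    (hsub : ∀ᶠ u : ℝ in RareEvents.levelFilter (ϕ ζ),
      RareEvents.exceedanceSet ϕ (u : EReal) ⊆ Xhat)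
    -- the conditions on the induced system, for which `ζ` is a fixed point
    (φ : X → ℝ) (hφ : Measurable φ)
    (hM1 : RareEvents.CondM1 (RareEvents.inducedSystem f Xhat)
      (RareEvents.inducedPotential f Xhat φ))
    (hM2 : RareEvents.CondM2 (RareEvents.inducedSystem f Xhat)
      (RareEvents.inducedPotential f Xhat φ) (ProbabilityTheory.cond μ Xhat))
    (hS1 : RareEvents.CondS1 (RareEvents.inducedSystem f Xhat) ϕ ζ 1)
    (hS2 : RareEvents.CondS2 (RareEvents.inducedSystem f Xhat)
      (RareEvents.inducedPotential f Xhat φ) ζ 1)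
    -- the limiting distributions for the induced system, on a family of sets such as
    -- `intervalRing` or `intervalSemiring`
    (𝒥 : Set (Set ℝ)) (h𝒥 : 𝒥 ⊆ RareEvents.intervalRing)
    (hdil : ∀ J ∈ 𝒥, ∀ s : ℝ, 0 < s → s • J ∈ 𝒥)
    (Hhat : Set ℝ → ℕ → ℝ)
    (hH : ∀ J ∈ 𝒥, ∀ κ : ℕ,
      Tendsto (fun u : ℝ => RareEvents.countingDistribution (ProbabilityTheory.cond μ Xhat)
        (RareEvents.firstReturnMap f Xhat) ϕ u J κ)
        (RareEvents.levelFilter (ϕ ζ)) (𝓝 (Hhat J κ)))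
    (hHdf : ∀ J ∈ 𝒥, RareEvents.IsNatDistributionFunction (Hhat J))
    (hHcont : ∀ J ∈ 𝒥, ∀ κ : ℕ,
      Tendsto (fun δ : ℝ => Hhat ((1 + δ) • J) κ) (𝓝 0) (𝓝 (Hhat J κ))) :
    ∀ J ∈ 𝒥, ∃ δ : ℝ → ℝ,
      (∀ u : ℝ, (u : EReal) < ϕ ζ → 0 < δ u) ∧
      AntitoneOn δ {u : ℝ | (u : EReal) < ϕ ζ} ∧
      Tendsto δ (RareEvents.levelFilter (ϕ ζ)) (𝓝 0) ∧
      ∀ u : ℝ, (u : EReal) < ϕ ζ → ∀ κ : ℕ,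
        |RareEvents.countingDistribution μ f ϕ u J κ - Hhat J κ| < δ u := by
  intro J hJ
  obtain ⟨E, hE⟩ := RareEvents.exists_isStepSet_of_mem_intervalRing (h𝒥 hJ)
  obtain ⟨hprob, -, hT⟩ := hM2.1.1
  -- Conditioning on a null set gives the zero measure, which is not a probability measure.
  have hs0 : μ Xhat ≠ 0 := by
    intro h0
    have := hprob.measure_univ
    rw [ProbabilityTheory.cond_eq_zero_of_meas_eq_zero h0] at this
    simp at this
  have hclose : ∀ ε > 0, ∀ᶠ u : ℝ in RareEvents.levelFilter (ϕ ζ), ∀ κ : ℕ,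
      |RareEvents.countingDistribution μ f ϕ u J κ -
        RareEvents.countingDistribution (ProbabilityTheory.cond μ Xhat)
          (RareEvents.firstReturnMap f Xhat) ϕ u J κ| ≤ ε := by
    intro ε hε
    obtain ⟨η, hη, h⟩ := RareEvents.exists_forall_abs_hitCount_sub_le hμ hXhat hs0 hT hE hε
    filter_upwards [hsub, (hR1.tendsto_measureReal_exceedanceSet hmax).eventually
      (gt_mem_nhds hη)] with u hu huη κ
    -- `exceedanceCount` is by definition `hitCount` of the exceedance set.
    exact h _ hu (hϕ measurableSet_Ioi) huη κ
  have hlim : ∀ κ : ℕ, Tendsto (fun u : ℝ => RareEvents.countingDistribution μ f ϕ u J κ)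
      (RareEvents.levelFilter (ϕ ζ)) (𝓝 (Hhat J κ)) := by
    intro κ
    have h0 : Tendsto (fun u : ℝ => RareEvents.countingDistribution μ f ϕ u J κ -
        RareEvents.countingDistribution (ProbabilityTheory.cond μ Xhat)
          (RareEvents.firstReturnMap f Xhat) ϕ u J κ)
        (RareEvents.levelFilter (ϕ ζ)) (𝓝 0) := by
      rw [Metric.tendsto_nhds]
      intro ε hε
      filter_upwards [hclose (ε / 2) (half_pos hε)] with u hu
      rw [Real.dist_eq, sub_zero]
      exact (hu κ).trans_lt (half_lt_self hε)
    simpa using h0.add (hH J hJ κ)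
  have hG0 : ∀ (u : ℝ) (κ : ℕ), 0 ≤ RareEvents.countingDistribution μ f ϕ u J κ :=
    fun u κ => measureReal_nonneg
  have hG1 : ∀ (u : ℝ) (κ : ℕ), RareEvents.countingDistribution μ f ϕ u J κ ≤ 1 :=
    fun u κ => measureReal_le_one
  have hmono : ∀ u : ℝ, Monotone (RareEvents.countingDistribution μ f ϕ u J) :=
    fun u k k' hk => measureReal_mono fun x hx => le_trans (b := (k : ℕ∞)) hx
      (by exact_mod_cast hk)
  have hdf := hHdf J hJ
  have hH0 : ∀ κ, 0 ≤ Hhat J κ := fun κ => hdf.1.trans (hdf.2.1 (Nat.zero_le κ))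
  have hH1 : ∀ κ, Hhat J κ ≤ 1 := fun κ => hdf.2.1.ge_of_tendsto hdf.2.2 κ
  exact RareEvents.exists_antitoneOn_bound (M := 1)
    (D := fun u κ => |RareEvents.countingDistribution μ f ϕ u J κ - Hhat J κ|)
    (fun u κ => abs_nonneg _)
    (fun u κ => abs_le.2 ⟨by linarith [hG0 u κ, hH1 κ], by linarith [hG1 u κ, hH0 κ]⟩)
    (fun ε hε => hdf.eventually_forall_abs_sub_le hmono hG1 hlim hε)
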